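/- Let $n,p,q\ge 0$ be integers; all matrices are real $n\times n$, and $[n]=\{1,\dots,n\}$. Definitions. A matrix $T$ is \emph{banded of type $(p,q)$} if $T_{ij}=0$ whenever $i-j>p$ or $j-i>q$. A minor $\det\big(T_{i_a,j_b}\big)_{a,b=1}^{r}$, with $i_1<\dots<i_r$ and $j_1<\dots<j_r$ in $[n]$, is \emph{nontrivial} (for the band $(p,q)$) if $-p\le j_k-i_k\le q$ for every $k\in\{1,\dots,r\}$. The matrix $T$ is \emph{banded totally positive of type $(p,q)$} if it is banded of type $(p,q)$ and all its nontrivial minors are positive. A \emph{positive lower bidiagonal matrix} is a matrix with all diagonal entries equal to $1$, all entries on the first subdiagonal positive, and all other entries $0$; a \emph{positive upper bidiagonal matrix} is the transpose of such a matrix. A \emph{positive bidiagonal factorization} (PBF) of $T$ is a factorization $$T=L_1\cdots L_p\,D\,U_q\cdots U_1$$ in which every $L_a$ is positive lower bidiagonal, every $U_b$ is positive upper bidiagonal and $D$ is a diagonal matrix with positive diagonal entries. Proposition. (i) Every matrix $T$ that has a positive bidiagonal factorization $T=L_1\cdots L_pDU_q\cdots U_1$ is banded totally positive of type $(p,q)$.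 (ii) For every positive bidiagonal factorization $T=L_1\cdots L_pDU_q\cdots U_1$, all its Darboux transformations $$\hat T^{[+k]}=L_{k+1}\cdots L_p\,D\,U_q\cdots U_1\,L_1\cdots L_k\quad(1\le k\le p),\qquad \hat T^{[-k]}=U_k\cdots U_1\,L_1\cdots L_p\,D\,U_q\cdots U_{k+1}\quad(1\le k\le q)$$ are banded totally positive of type $(p,q)$ as well. -/

import Mathlib

namespace BandedTP

/-- `T` is banded with `p` subdiagonals and `q` superdiagonals: every entry strictly below the
`p`-th subdiagonal or strictly above the `q`-th superdiagonal is zero. -/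
def IsBanded {n : ℕ} (p q : ℕ) (T : Matrix (Fin n) (Fin n) ℝ) : Prop :=
  ∀ i j : Fin n, ((j : ℕ) + p < (i : ℕ) ∨ (i : ℕ) + q < (j : ℕ)) → T i j = 0

/-- The minor of `T` with rows `i 0, …, i (r - 1)` and columns `j 0, …, j (r - 1)`. -/
def minor {n r : ℕ} (T : Matrix (Fin n) (Fin n) ℝ) (i j : Fin r → Fin n) : ℝ :=
  (T.submatrix i j).det

/-- The submatrix with row labels `i` and column labels `j` is trivial for the band `(p, q)`: some
position `(i k, j k)` of its diagonal lies strictly below the `p`-th subdiagonal or strictly above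
the `q`-th superdiagonal. -/
def IsTrivialMinor {n r : ℕ} (p q : ℕ) (i j : Fin r → Fin n) : Prop :=
  ∃ k : Fin r, (j k : ℕ) + p < (i k : ℕ) ∨ (i k : ℕ) + q < (j k : ℕ)

/-- `T` is banded totally positive, with `p` subdiagonals and `q` superdiagonals: `T` is banded and
all its nontrivial minors are positive. -/
def IsBTP {n : ℕ} (p q : ℕ) (T : Matrix (Fin n) (Fin n) ℝ) : Prop :=
  IsBanded p q T ∧
    ∀ (r : ℕ) (i j : Fin r → Fin n), StrictMono i → StrictMono j →
      ¬ IsTrivialMinor p q i j → 0 < minor T i j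

/-- Positive lower bidiagonal matrices: ones on the diagonal, positive entries on the first
subdiagonal, zeros elsewhere. -/
structure IsPosLowerBidiagonal {n : ℕ} (L : Matrix (Fin n) (Fin n) ℝ) : Prop where
  diag_eq_one : ∀ i : Fin n, L i i = 1
  subdiag_pos : ∀ i j : Fin n, (i : ℕ) = (j : ℕ) + 1 → 0 < L i j
  eq_zero : ∀ i j : Fin n, i ≠ j → (i : ℕ) ≠ (j : ℕ) + 1 → L i j = 0

/-- Positive upper bidiagonal matrices: ones on the diagonal, positive entries on the first
superdiagonal, zeros elsewhere. -/
structure IsPosUpperBidiagonal {n : ℕ} (U : Matrix (Fin n) (Fin n) ℝ) : Prop where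
  diag_eq_one : ∀ i : Fin n, U i i = 1
  superdiag_pos : ∀ i j : Fin n, (j : ℕ) = (i : ℕ) + 1 → 0 < U i j
  eq_zero : ∀ i j : Fin n, i ≠ j → (j : ℕ) ≠ (i : ℕ) + 1 → U i j = 0

/-- A positive bidiagonal factorization `T = L₁ ⋯ L_p D U_q ⋯ U₁`. The factor `L_a` is
`lower (a - 1)`, the factor `U_b` is `upper (b - 1)`, and `D` is the diagonal matrix of `diag`. -/
structure PBFactorization {n : ℕ} (p q : ℕ) (T : Matrix (Fin n) (Fin n) ℝ) where
  lower : Fin p → Matrix (Fin n) (Fin n) ℝ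
  diag : Fin n → ℝ
  upper : Fin q → Matrix (Fin n) (Fin n) ℝ
  lower_pos : ∀ a, IsPosLowerBidiagonal (lower a)
  diag_pos : ∀ m, 0 < diag m
  upper_pos : ∀ b, IsPosUpperBidiagonal (upper b)
  eq_prod : T = (List.ofFn lower).prod * Matrix.diagonal diag * (List.ofFn upper).reverse.prod

/-- `T` is PBF (with `p` lower and `q` upper factors). -/
def IsPBF {n : ℕ} (p q : ℕ) (T : Matrix (Fin n) (Fin n) ℝ) : Prop :=
  Nonempty (PBFactorization p q T)

/-- The Darboux transformation `T^[+k] = L_{k+1} ⋯ L_p D U_q ⋯ U₁ L₁ ⋯ L_k`, for `1 ≤ k ≤ p`. -/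
def PBFactorization.darbouxPlus {n p q : ℕ} {T : Matrix (Fin n) (Fin n) ℝ}
    (F : PBFactorization p q T) (k : ℕ) : Matrix (Fin n) (Fin n) ℝ :=
  ((List.ofFn F.lower).drop k).prod * Matrix.diagonal F.diag * (List.ofFn F.upper).reverse.prod *
    ((List.ofFn F.lower).take k).prod

/-- The Darboux transformation `T^[-k] = U_k ⋯ U₁ L₁ ⋯ L_p D U_q ⋯ U_{k+1}`, for `1 ≤ k ≤ q`. -/
def PBFactorization.darbouxMinus {n p q : ℕ} {T : Matrix (Fin n) (Fin n) ℝ}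
    (F : PBFactorization p q T) (k : ℕ) : Matrix (Fin n) (Fin n) ℝ :=
  ((List.ofFn F.upper).take k).reverse.prod * (List.ofFn F.lower).prod * Matrix.diagonal F.diag *
    ((List.ofFn F.upper).drop k).reverse.prod

end BandedTP

namespace BandedTP

open Finset

variable {n : ℕ}

/-! Left multiplication by a thin-band factor preserves `IsNonnegBTP` and adds the bandwidths
(`IsThinBand.mul`). Lower bidiagonal, upper bidiagonal and positive diagonal factors are all thin,
so a product built up from the identity depends only on how many of each kind occur, not on their
order; `T` and its Darboux transformations are therefore treated alike. Nonnegativity of trivial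
minors must be carried along because they occur in the expansion of a minor of the product. -/

/-- Banded totally positive matrices all of whose minors, trivial or not, are nonnegative. -/
structure IsNonnegBTP (p q : ℕ) (T : Matrix (Fin n) (Fin n) ℝ) : Prop where
  isBTP : IsBTP p q T
  minor_nonneg : ∀ (r : ℕ) (i j : Fin r → Fin n), StrictMono i → StrictMono j → 0 ≤ minor T i j

/-- Nonnegative matrices, positive exactly on the band `(a, b)`, in which the supports of
successive rows overlap in at most one column. -/
structure IsThinBand (a b : ℕ) (B : Matrix (Fin n) (Fin n) ℝ) : Prop where
  banded : IsBanded a b B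
  pos : ∀ i k : Fin n, (i : ℕ) ≤ k + a → (k : ℕ) ≤ i + b → 0 < B i k
  thin : a + b ≤ 1

namespace IsThinBand

variable {a b : ℕ} {B : Matrix (Fin n) (Fin n) ℝ}

theorem nonneg (hB : IsThinBand a b B) (i k : Fin n) : 0 ≤ B i k := by
  by_cases h : (k : ℕ) + a < i ∨ (i : ℕ) + b < k
  · exact (hB.banded i k h).ge
  · exact (hB.pos i k (by omega) (by omega)).le

theorem le_add_of_ne_zero (hB : IsThinBand a b B) {i k : Fin n} (h : B i k ≠ 0) :
    (i : ℕ) ≤ k + a ∧ (k : ℕ) ≤ i + b := by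
  by_contra hk
  exact h (hB.banded i k (by omega))

/-- For `s < t`, `f s ≤ i s + b ≤ i t - 1 + b ≤ f t + (a + b - 1)`, and `a + b ≤ 1`. -/
theorem monotone_of_ne_zero (hB : IsThinBand a b B) {r : ℕ} {i f : Fin r → Fin n}
    (hi : StrictMono i) (h : ∀ s, B (i s) (f s) ≠ 0) : Monotone f := by
  intro s t hst
  rcases hst.eq_or_lt with rfl | hst
  · exact le_rfl
  · have h1 := hB.le_add_of_ne_zero (h s)
    have h2 := hB.le_add_of_ne_zero (h t)
    have h3 : (i s : ℕ) < i t := hi hst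
    have h4 := hB.thin
    show (f s : ℕ) ≤ f t
    omega

end IsThinBand

/-- Expansion of a minor of a product along the rows of the left factor. -/
theorem minor_mul (B T : Matrix (Fin n) (Fin n) ℝ) {r : ℕ} (i j : Fin r → Fin n) :
    minor (B * T) i j = ∑ f : Fin r → Fin n, (∏ s, B (i s) (f s)) * minor T f j := by
  have h := (Matrix.detRowAlternating (n := Fin r) (R := ℝ)).toMultilinearMap.map_sum
    (fun s (k : Fin n) => B (i s) k • fun t => T k (j t))
  have h' : (B * T).submatrix i j = fun s => ∑ k, B (i s) k • fun t => T k (j t) := by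
    ext s t
    simp [Matrix.mul_apply]
  unfold minor
  rw [h']
  refine h.trans (sum_congr rfl fun f _ => ?_)
  exact (MultilinearMap.map_smul_univ _ (fun s => B (i s) (f s)) (fun s t => T (f s) (j t)))

/-- Thinness lets the sum run over all `f` without signs: a nonzero coefficient makes `f` monotone,
hence either strictly increasing or repeating a row. -/
theorem IsThinBand.minor_mul_term_nonneg {a b p q : ℕ} {B T : Matrix (Fin n) (Fin n) ℝ}
    (hB : IsThinBand a b B) (hT : IsNonnegBTP p q T) {r : ℕ} {i j : Fin r → Fin n}
    (hi : StrictMono i) (hj : StrictMono j) (f : Fin r → Fin n) :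
    0 ≤ (∏ s, B (i s) (f s)) * minor T f j := by
  by_cases h : ∀ s, B (i s) (f s) ≠ 0
  · refine mul_nonneg (prod_nonneg fun s _ => hB.nonneg _ _) ?_
    by_cases hf : Function.Injective f
    · exact hT.minor_nonneg r f j ((hB.monotone_of_ne_zero hi h).strictMono_of_injective hf) hj
    · obtain ⟨s, t, hst, hne⟩ := Function.not_injective_iff.mp hf
      refine (Matrix.det_zero_of_row_eq hne ?_).ge
      ext u
      simp [hst]
  · push Not at h
    obtain ⟨s, hs⟩ := h
    rw [prod_eq_zero (mem_univ s) hs, zero_mul]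

/-- Between the rows and the columns of a nontrivial minor for the band `(p + a, q + b)` lies an
increasing sequence that is nontrivial for `(a, b)` and `(p, q)`, respectively. -/
theorem exists_strictMono_between {a b p q r : ℕ} {i j : Fin r → Fin n}
    (hi : StrictMono i) (hj : StrictMono j) (h : ¬ IsTrivialMinor (p + a) (q + b) i j) :
    ∃ k : Fin r → Fin n, StrictMono k ∧ ¬ IsTrivialMinor a b i k ∧ ¬ IsTrivialMinor p q k j := by
  unfold IsTrivialMinor at *
  push Not at *
  have le_apply : ∀ {g : Fin r → Fin n}, StrictMono g → ∀ s : Fin r, (s : ℕ) ≤ g s := by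
    rintro g hg ⟨s, hs⟩
    induction s with
    | zero => exact Nat.zero_le _
    | succ s ih =>
      have h1 := ih (by omega)
      have h2 : (g ⟨s, by omega⟩ : ℕ) < g ⟨s + 1, hs⟩ := hg (Nat.lt_succ_self s)
      simp only at *
      omega
  -- The least choice allowed by both bands. The extra `s` keeps it strictly increasing where both
  -- truncated subtractions give `0`.
  refine ⟨fun s => ⟨max (max ((i s : ℕ) - a) ((j s : ℕ) - q)) s, ?_⟩, ?_, ?_, ?_⟩
  · have := le_apply hi s
    omega
  · intro s t hst
    have h1 : (i s : ℕ) < i t := hi hst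
    have h2 : (j s : ℕ) < j t := hj hst
    have h3 : (s : ℕ) < t := hst
    show max (max ((i s : ℕ) - a) ((j s : ℕ) - q)) s < max (max ((i t : ℕ) - a) ((j t : ℕ) - q)) t
    omega
  all_goals
    intro s
    have := h s
    have := le_apply hi s
    have := le_apply hj s
    simp only
    omega

theorem IsBanded.mul {a b p q : ℕ} {B T : Matrix (Fin n) (Fin n) ℝ} (hB : IsBanded a b B)
    (hT : IsBanded p q T) : IsBanded (p + a) (q + b) (B * T) := by
  intro i j h
  rw [Matrix.mul_apply]
  refine sum_eq_zero fun k _ => ?_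
  by_cases hk : (k : ℕ) + a < i ∨ (i : ℕ) + b < k
  · rw [hB i k hk, zero_mul]
  · rw [hT k j (by omega), mul_zero]

theorem IsThinBand.mul {a b p q : ℕ} {B T : Matrix (Fin n) (Fin n) ℝ}
    (hB : IsThinBand a b B) (hT : IsNonnegBTP p q T) : IsNonnegBTP (p + a) (q + b) (B * T) where
  isBTP := by
    refine ⟨hB.banded.mul hT.isBTP.1, fun r i j hi hj h => ?_⟩
    obtain ⟨k, hk, hik, hkj⟩ := exists_strictMono_between hi hj h
    rw [minor_mul]
    -- No term can cancel another, so the intermediate sequence `k` alone gives positivity.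
    refine sum_pos' (fun f _ => hB.minor_mul_term_nonneg hT hi hj f) ⟨k, mem_univ _, ?_⟩
    refine mul_pos (prod_pos fun s _ => ?_) (hT.isBTP.2 r k j hk hj hkj)
    unfold IsTrivialMinor at hik
    push Not at hik
    exact hB.pos _ _ (hik s).1 (hik s).2
  minor_nonneg r i j hi hj := by
    rw [minor_mul]
    exact sum_nonneg fun f _ => hB.minor_mul_term_nonneg hT hi hj f

theorem IsPosLowerBidiagonal.isThinBand {L : Matrix (Fin n) (Fin n) ℝ}
    (hL : IsPosLowerBidiagonal L) : IsThinBand 1 0 L where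
  banded i j h := hL.eq_zero i j (by rintro rfl; omega) (by omega)
  pos i k h1 h2 := by
    rcases eq_or_ne i k with rfl | h
    · rw [hL.diag_eq_one]
      exact one_pos
    · exact hL.subdiag_pos i k (by have := Fin.val_ne_of_ne h; omega)
  thin := le_rfl

theorem IsPosUpperBidiagonal.isThinBand {U : Matrix (Fin n) (Fin n) ℝ}
    (hU : IsPosUpperBidiagonal U) : IsThinBand 0 1 U where
  banded i j h := hU.eq_zero i j (by rintro rfl; omega) (by omega)
  pos i k h1 h2 := by
    rcases eq_or_ne i k with rfl | h
    · rw [hU.diag_eq_one]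
      exact one_pos
    · exact hU.superdiag_pos i k (by have := Fin.val_ne_of_ne h; omega)
  thin := le_rfl

theorem isThinBand_diagonal {d : Fin n → ℝ} (hd : ∀ m, 0 < d m) :
    IsThinBand 0 0 (Matrix.diagonal d) where
  banded i j h := Matrix.diagonal_apply_ne _ (by rintro rfl; omega)
  pos i k h1 h2 := by
    obtain rfl : i = k := Fin.ext (by omega)
    rw [Matrix.diagonal_apply_eq]
    exact hd i
  thin := Nat.zero_le _

theorem minor_one_self {r : ℕ} {i : Fin r → Fin n} (hi : StrictMono i) :
    minor (1 : Matrix (Fin n) (Fin n) ℝ) i i = 1 := by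
  unfold minor
  rw [Matrix.submatrix_one i hi.injective, Matrix.det_one]

theorem minor_one_of_ne {r : ℕ} {i j : Fin r → Fin n} (hi : StrictMono i) (hj : StrictMono j)
    (h : i ≠ j) : minor (1 : Matrix (Fin n) (Fin n) ℝ) i j = 0 := by
  -- Otherwise the ranges, having equal size, coincide, and a strictly increasing sequence is
  -- determined by its range.
  have hex : ∃ s, ∀ t, i s ≠ j t := by
    by_contra! hcon
    have hsub : univ.image i ⊆ univ.image j := by
      intro x hx
      obtain ⟨s, -, rfl⟩ := mem_image.mp hx
      obtain ⟨t, ht⟩ := hcon s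
      exact mem_image.mpr ⟨t, mem_univ t, ht.symm⟩
    have heq := eq_of_subset_of_card_le hsub
      (by rw [card_image_of_injective _ hi.injective, card_image_of_injective _ hj.injective])
    refine h ((StrictMono.range_inj hi hj).mp ?_)
    simpa using congrArg (fun s : Finset (Fin n) => (s : Set (Fin n))) heq
  obtain ⟨s, hs⟩ := hex
  exact Matrix.det_eq_zero_of_row_eq_zero s fun t => Matrix.one_apply_ne (hs t)

theorem isNonnegBTP_one : IsNonnegBTP 0 0 (1 : Matrix (Fin n) (Fin n) ℝ) where
  isBTP := by
    refine ⟨fun i j h => Matrix.one_apply_ne (by rintro rfl; omega), fun r i j hi hj h => ?_⟩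
    unfold IsTrivialMinor at h
    push Not at h
    obtain rfl : i = j := funext fun s => Fin.ext (by have := h s; omega)
    rw [minor_one_self hi]
    exact one_pos
  minor_nonneg r i j hi hj := by
    rcases eq_or_ne i j with rfl | h
    · rw [minor_one_self hi]
      exact zero_le_one
    · exact (minor_one_of_ne hi hj h).ge

theorem IsNonnegBTP.list_lower_mul {p q : ℕ} {T : Matrix (Fin n) (Fin n) ℝ}
    (hT : IsNonnegBTP p q T) : ∀ l : List (Matrix (Fin n) (Fin n) ℝ),
    (∀ L ∈ l, IsPosLowerBidiagonal L) → IsNonnegBTP (p + l.length) q (l.prod * T)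
  | [], _ => by simpa using hT
  | L :: l, h => by
    rw [List.prod_cons, mul_assoc]
    exact (h L List.mem_cons_self).isThinBand.mul
      (hT.list_lower_mul l fun M hM => h M (List.mem_cons_of_mem _ hM))

theorem IsNonnegBTP.list_upper_mul {p q : ℕ} {T : Matrix (Fin n) (Fin n) ℝ}
    (hT : IsNonnegBTP p q T) : ∀ l : List (Matrix (Fin n) (Fin n) ℝ),
    (∀ U ∈ l, IsPosUpperBidiagonal U) → IsNonnegBTP p (q + l.length) (l.prod * T)
  | [], _ => by simpa using hT
  | U :: l, h => by
    rw [List.prod_cons, mul_assoc]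
    exact (h U List.mem_cons_self).isThinBand.mul
      (hT.list_upper_mul l fun M hM => h M (List.mem_cons_of_mem _ hM))

namespace PBFactorization

variable {p q : ℕ} {T : Matrix (Fin n) (Fin n) ℝ}

theorem isPosLowerBidiagonal_of_mem (F : PBFactorization p q T) {L : Matrix (Fin n) (Fin n) ℝ}
    (h : L ∈ List.ofFn F.lower) : IsPosLowerBidiagonal L := by
  obtain ⟨a, rfl⟩ := (List.mem_ofFn' _ _).mp h
  exact F.lower_pos a

theorem isPosUpperBidiagonal_of_mem (F : PBFactorization p q T) {U : Matrix (Fin n) (Fin n) ℝ}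
    (h : U ∈ List.ofFn F.upper) : IsPosUpperBidiagonal U := by
  obtain ⟨b, rfl⟩ := (List.mem_ofFn' _ _).mp h
  exact F.upper_pos b

theorem isBTP_darbouxPlus (F : PBFactorization p q T) {k : ℕ} (hk : k ≤ p) :
    IsBTP p q (F.darbouxPlus k) := by
  have h1 := isNonnegBTP_one.list_lower_mul ((List.ofFn F.lower).take k)
    fun L hL => F.isPosLowerBidiagonal_of_mem (List.mem_of_mem_take hL)
  have h2 := h1.list_upper_mul (List.ofFn F.upper).reverse
    fun U hU => F.isPosUpperBidiagonal_of_mem (List.mem_reverse.mp hU)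
  have h3 := ((isThinBand_diagonal F.diag_pos).mul h2).list_lower_mul ((List.ofFn F.lower).drop k)
    fun L hL => F.isPosLowerBidiagonal_of_mem (List.mem_of_mem_drop hL)
  convert h3.isBTP using 1
  · simp
    omega
  · simp
  · simp [darbouxPlus, mul_assoc]

theorem isBTP_darbouxMinus (F : PBFactorization p q T) {k : ℕ} (hk : k ≤ q) :
    IsBTP p q (F.darbouxMinus k) := by
  have h1 := isNonnegBTP_one.list_upper_mul ((List.ofFn F.upper).drop k).reverse
    fun U hU => F.isPosUpperBidiagonal_of_mem (List.mem_of_mem_drop (List.mem_reverse.mp hU))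
  have h2 := ((isThinBand_diagonal F.diag_pos).mul h1).list_lower_mul (List.ofFn F.lower)
    fun L hL => F.isPosLowerBidiagonal_of_mem hL
  have h3 := h2.list_upper_mul ((List.ofFn F.upper).take k).reverse
    fun U hU => F.isPosUpperBidiagonal_of_mem (List.mem_of_mem_take (List.mem_reverse.mp hU))
  convert h3.isBTP using 1
  · simp
  · simp
    omega
  · simp [darbouxMinus, mul_assoc]

theorem isBTP (F : PBFactorization p q T) : IsBTP p q T := by
  -- For `k = 0` nothing is moved to the right, so the transformation is `T` itself.
  have h := F.isBTP_darbouxPlus (Nat.zero_le p)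
  have hT : F.darbouxPlus 0 = T := by
    rw [darbouxPlus, List.take_zero, List.drop_zero, List.prod_nil, mul_one]
    exact F.eq_prod.symm
  rwa [hT] at h

end PBFactorization

end BandedTP

theorem mainTheorem10 (n p q : ℕ) (T : Matrix (Fin n) (Fin n) ℝ) :
    (BandedTP.IsPBF p q T → BandedTP.IsBTP p q T) ∧
    ∀ F : BandedTP.PBFactorization p q T,
      (∀ k : ℕ, 1 ≤ k → k ≤ p → BandedTP.IsBTP p q (F.darbouxPlus k)) ∧
      (∀ k : ℕ, 1 ≤ k → k ≤ q → BandedTP.IsBTP p q (F.darbouxMinus k)) :=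
  ⟨fun ⟨F⟩ => F.isBTP,
    fun F => ⟨fun _ _ hk => F.isBTP_darbouxPlus hk, fun _ _ hk => F.isBTP_darbouxMinus hk⟩⟩
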